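/- A vocabulary is a set of relation symbols. The spectrum $\mathrm{spec}(\varphi)$ of a first-order sentence $\varphi$ (with equality) over a vocabulary is the set of all positive integers $n$ such that $\varphi$ has a model with exactly $n$ elements. Let $x,x_1,x_2,\ldots$ and $y,y_1,y_2,\ldots$ be two disjoint sorts of variables ranging over the natural numbers $\mathbb N=\{0,1,2,\ldots\}$. For $a,b\in\mathbb N$ let $\mathrm{Bit}(a,b)$ hold if and only if the binary digit of rank $b$ of $a$ (the coefficient of $2^b$) is $1$. Let $\mathrm{Mo}$ be the smallest class of predicates over the natural numbers in finitely many variables of these two sorts which contains the relations $u+v=w$ and $u\times v=w$ for all variables $u,v,w$ of sort $x$ and the relations $\mathrm{Bit}(v,u)$ for all variables $v$ of sort $y$ and $u$ of sort $x$, and which is closed under the Boolean operations $\neg,\wedge,\vee$ and under polynomially bounded quantification of variables of sort $x$, that is, under $\forall u<p$ and $\exists u<p$, where $u$ is a variable of sort $x$ and $p$ is a polynomial with coefficients in $\mathbb N$ in variables of sort $x$ other than $u$. Theorem. A set $S$ of natural numbers is the spectrum of some first-order sentence if and only if there are integers $k\ge 1$ and $j_1,\ldots,j_k\geq 1$ and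 a predicate $R(x,y_1,\ldots,y_k)$ in $\mathrm{Mo}$, with one variable $x$ of the first sort and $k$ variables $y_1,\dots,y_k$ of the second sort, such that $$S=\{x\in\mathbb N : x\ge 1 \text{ and } \exists y_1\leq 2^{x^{j_1}}\ldots\exists y_k\leq 2^{x^{j_k}}\ R(x,y_1,\ldots,y_k)\}.$$ -/

import Mathlib

namespace MoSpectra

open FirstOrder

/-- The spectrum of a first-order sentence: the set of cardinalities of its finite (nonempty)
models. -/
def foSpectrum {L : FirstOrder.Language.{0, 0}} (φ : L.Sentence) : Set ℕ :=
  {n | ∃ (M : Type) (_ : L.Structure M), Nonempty M ∧ Finite M ∧ M ⊨ φ ∧ Nat.card M = n}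

/-- The class of all spectra of first-order sentences (with equality) over vocabularies without
function symbols. -/
def FOSpec : Set (Set ℕ) :=
  {S | ∃ (L : FirstOrder.Language.{0, 0}) (_ : L.IsRelational) (φ : L.Sentence), S = foSpectrum φ}

/-- The class of two-sorted predicates on natural numbers. `MoClass R`, with
`R : (Fin m → ℕ) → (Fin n → ℕ) → Prop`, says that the predicate `R` in the type-`x` variables
`x 0, …, x (m - 1)` and the type-`y` variables `y 0, …, y (n - 1)` belongs to the smallest class
containing the graphs of `+` and `×` on type-`x` variables and the predicate `Bit` (the bit of
rank `x j` in the binary expansion of `y i` is `1`), and closed under Boolean operations and under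
quantification of type-`x` variables bounded by polynomials in the other type-`x` variables. -/
inductive MoClass : {m n : ℕ} → ((Fin m → ℕ) → (Fin n → ℕ) → Prop) → Prop
  | add {m n : ℕ} (i j k : Fin m) :
      MoClass (fun (x : Fin m → ℕ) (_ : Fin n → ℕ) => x i + x j = x k)
  | mul {m n : ℕ} (i j k : Fin m) :
      MoClass (fun (x : Fin m → ℕ) (_ : Fin n → ℕ) => x i * x j = x k)
  | bit {m n : ℕ} (i : Fin n) (j : Fin m) :
      MoClass (fun (x : Fin m → ℕ) (y : Fin n → ℕ) => (y i).testBit (x j) = true)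
  | not {m n : ℕ} {R : (Fin m → ℕ) → (Fin n → ℕ) → Prop} :
      MoClass R → MoClass (fun x y => ¬ R x y)
  | and {m n : ℕ} {R S : (Fin m → ℕ) → (Fin n → ℕ) → Prop} :
      MoClass R → MoClass S → MoClass (fun x y => R x y ∧ S x y)
  | or {m n : ℕ} {R S : (Fin m → ℕ) → (Fin n → ℕ) → Prop} :
      MoClass R → MoClass S → MoClass (fun x y => R x y ∨ S x y)
  | all {m n : ℕ} {R : (Fin (m + 1) → ℕ) → (Fin n → ℕ) → Prop} (p : MvPolynomial (Fin m) ℕ) :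
      MoClass R → MoClass (fun x y => ∀ z < MvPolynomial.eval x p, R (Fin.cons z x) y)
  | ex {m n : ℕ} {R : (Fin (m + 1) → ℕ) → (Fin n → ℕ) → Prop} (p : MvPolynomial (Fin m) ℕ) :
      MoClass R → MoClass (fun x y => ∃ z < MvPolynomial.eval x p, R (Fin.cons z x) y)

/-- The sets of positive integers `x` defined by
`∃ y₁ ≤ 2 ^ (x ^ j₁), …, ∃ yₖ ≤ 2 ^ (x ^ jₖ), R (x, y₁, …, yₖ)` with `k, j₁, …, jₖ ≥ 1`
and `R` in `MoClass`. -/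
def MoDefinable : Set (Set ℕ) :=
  {S | ∃ k : ℕ, 1 ≤ k ∧ ∃ j : Fin k → ℕ, (∀ i, 1 ≤ j i) ∧
    ∃ R : (Fin 1 → ℕ) → (Fin k → ℕ) → Prop, MoClass R ∧
      S = {x : ℕ | 1 ≤ x ∧ ∃ y : Fin k → ℕ, (∀ i, y i ≤ 2 ^ (x ^ j i)) ∧ R ![x] y}}

end MoSpectra

namespace MoSpectra

open FirstOrder

/-! A relation of arity `l` on `{0, …, n - 1}` is a set of base-`n` numerals with `l` digits, hence
a number `y < 2 ^ (n ^ l)`. A model of size `n` thus becomes a tuple of bounded numbers. In the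
satisfaction relation, quantifiers over elements become quantifiers bounded by `n`, and an atom
becomes a bit whose rank is a polynomial in `n` and the elements (`exists_moClass_realize_iff`).
Only the finitely many symbols occurring in the sentence matter.

Conversely, let `d`-tuples over an `n`-element set stand for the numbers below `n ^ d`. Finitely
many axioms on an order, an addition and a multiplication of tuples force them to be truncated
arithmetic (`ArithAxioms.exists_isRank`). Making the `n` diagonal tuples an initial segment names
the number `n`: it is the rank of the least non-diagonal tuple. For `n ≥ 2`, a predicate in Mo
evaluated at `n` quantifies only over numbers bounded by some `n ^ c`, with `c` depending on the
predicate alone, so for large `d` it is a first-order formula on tuples (`MoClass.expressible`).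
Each `y` is a set of tuples, and its bound is a condition on bits. Size one, where `n ^ d = n`, gets
its own disjunct. -/

/-! ### Spectra are Mo-definable -/

theorem MoClass.reindex {m n : ℕ} {R : (Fin m → ℕ) → (Fin n → ℕ) → Prop} (h : MoClass R) :
    ∀ {m' : ℕ} (f : Fin m → Fin m'), MoClass fun x y => R (x ∘ f) y := by
  induction h with
  | add i j k => exact fun f => .add (f i) (f j) (f k)
  | mul i j k => exact fun f => .mul (f i) (f j) (f k)
  | bit i j => exact fun f => .bit i (f j)
  | not _ ih => exact fun f => .not (ih f)
  | and _ _ ih₁ ih₂ => exact fun f => .and (ih₁ f) (ih₂ f)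
  | or _ _ ih₁ ih₂ => exact fun f => .or (ih₁ f) (ih₂ f)
  | all p _ ih =>
    intro m' f
    convert MoClass.all (p.rename f) (ih (Fin.cons 0 (Fin.succ ∘ f))) using 6 with x y z
    · rw [MvPolynomial.eval_rename]
    · ext i
      refine Fin.cases ?_ (fun i => ?_) i <;> simp
  | ex p _ ih =>
    intro m' f
    convert MoClass.ex (p.rename f) (ih (Fin.cons 0 (Fin.succ ∘ f))) using 7 with x y z
    · rw [MvPolynomial.eval_rename]
    · ext i
      refine Fin.cases ?_ (fun i => ?_) i <;> simp

theorem MoClass.eq {m n : ℕ} (i j : Fin m) :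
    MoClass fun (x : Fin m → ℕ) (_ : Fin n → ℕ) => x i = x j := by
  -- Equality is addition of some `z < 1`.
  convert MoClass.ex 1 (MoClass.add (n := n) (i.succ) 0 (j.succ)) using 3 with x y
  simp

theorem MoClass.false {m n : ℕ} : MoClass fun (_ : Fin m → ℕ) (_ : Fin n → ℕ) => False := by
  convert MoClass.ex 0 (MoClass.add (n := n) (0 : Fin (m + 1)) 0 0) using 3 with x y
  simp

theorem MoClass.testBit_eval {m n : ℕ} (i : Fin n) (p : MvPolynomial (Fin m) ℕ) :
    MoClass fun (x : Fin m → ℕ) (y : Fin n → ℕ) => (y i).testBit (MvPolynomial.eval x p) = true := by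
  -- The value of `p` is the `z < p + 1` that differs from every `w < p`.
  convert MoClass.ex (p + 1) ((MoClass.ex (p.rename Fin.succ)
    (MoClass.eq (n := n) 0 1)).not.and (MoClass.bit i 0)) using 3 with x y
  have h (z : ℕ) : (Fin.cons z x ∘ Fin.succ : Fin m → ℕ) = x := by ext; simp
  simp only [MvPolynomial.eval_rename, h, map_add, map_one, Fin.cons_zero, Fin.cons_one,
    exists_eq_right, not_lt]
  constructor
  · exact fun h => ⟨_, Nat.lt_succ_self _, le_rfl, h⟩
  · rintro ⟨z, h₁, h₂, h₃⟩
    rwa [le_antisymm h₂ (Nat.lt_succ_iff.1 h₁)]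

/-- Bounded formulas bind the last variable, whereas `MoClass` binds the first. -/
theorem MoClass.all_snoc {m n : ℕ} {R : (Fin (m + 1) → ℕ) → (Fin n → ℕ) → Prop} (h : MoClass R)
    (p : MvPolynomial (Fin m) ℕ) :
    MoClass fun x y => ∀ z < MvPolynomial.eval x p, R (Fin.snoc x z) y := by
  convert MoClass.all p (h.reindex (Fin.snoc Fin.succ 0)) using 6 with x y z
  ext i
  refine Fin.lastCases ?_ (fun i => ?_) i <;> simp

theorem exists_testBit_iff {N : ℕ} (P : ℕ → Prop) :
    ∃ y < 2 ^ N, ∀ t < N, y.testBit t = true ↔ P t := by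
  classical
  refine ⟨Nat.ofBits fun i : Fin N => decide (P i), Nat.ofBits_lt_two_pow _, fun t ht => ?_⟩
  simp [Nat.testBit_ofBits_lt _ _ ht]

/-- The numbers `y` code the relations in `F` on `Fin n`, the relation `R` being given by the bits
of `y (idx R)` of rank `finFunctionFinEquiv a`. -/
def Codes {L : FirstOrder.Language.{0, 0}} {k : ℕ} (F : Set (Σ l, L.Relations l))
    (idx : (Σ l, L.Relations l) → Fin k) (n : ℕ) [L.Structure (Fin n)] (y : Fin k → ℕ) : Prop :=
  ∀ R ∈ F, ∀ a : Fin R.1 → Fin n,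
    Language.Structure.RelMap R.2 a ↔ (y (idx R)).testBit (finFunctionFinEquiv a) = true

/-- Variable `0` of the predicate carries the size `n`, which bounds every quantifier and serves as
the base of the numerals in the atoms. `F` collects the symbols that occur and is fixed before
`idx`, so that `idx` can later be chosen injective on it. -/
theorem exists_moClass_realize_iff {L : FirstOrder.Language.{0, 0}} [L.IsRelational] {m : ℕ}
    (φ : L.BoundedFormula Empty m) :
    ∃ F : Set (Σ l, L.Relations l), F.Finite ∧ ∀ (k : ℕ) (idx : (Σ l, L.Relations l) → Fin k),
      ∃ R : (Fin (m + 1) → ℕ) → (Fin k → ℕ) → Prop, MoClass R ∧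
        ∀ (n : ℕ) [L.Structure (Fin n)] (y : Fin k → ℕ), Codes F idx n y →
          ∀ v : Fin m → Fin n, φ.Realize default v ↔ R (Fin.cons n fun i => v i) y := by
  have term {m : ℕ} (t : L.Term (Empty ⊕ Fin m)) : ∃ i, t = Language.Term.var (Sum.inr i) := by
    cases t with
    | var s =>
      rcases s with e | i
      exacts [e.elim, ⟨i, rfl⟩]
    | func f _ => exact isEmptyElim f
  induction φ with
  | falsum =>
    exact ⟨∅, Set.finite_empty, fun k idx => ⟨_, .false, fun n _ y _ v => Iff.rfl⟩⟩
  | equal t₁ t₂ =>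
    obtain ⟨i, rfl⟩ := term t₁
    obtain ⟨j, rfl⟩ := term t₂
    refine ⟨∅, Set.finite_empty, fun k idx => ⟨_, .eq i.succ j.succ, fun n _ y _ v => ?_⟩⟩
    simp [Language.BoundedFormula.Realize, Fin.val_inj]
  | @rel m l R ts =>
    choose g hg using fun i => term (ts i)
    refine ⟨{⟨l, R⟩}, Set.finite_singleton _, fun k idx => ⟨_, .testBit_eval (idx ⟨l, R⟩)
      (∑ i : Fin l, MvPolynomial.X (g i).succ * MvPolynomial.X 0 ^ (i : ℕ)), fun n _ y hy v => ?_⟩⟩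
    have := hy ⟨l, R⟩ rfl (v ∘ g)
    simp only [Language.BoundedFormula.Realize, hg, Language.Term.realize_var, Sum.elim_inr]
    rw [show (fun i => v (g i)) = v ∘ g from rfl, this, finFunctionFinEquiv_apply]
    simp
  | imp _ _ ih₁ ih₂ =>
    obtain ⟨F₁, hF₁, h₁⟩ := ih₁
    obtain ⟨F₂, hF₂, h₂⟩ := ih₂
    refine ⟨F₁ ∪ F₂, hF₁.union hF₂, fun k idx => ?_⟩
    obtain ⟨R₁, hR₁, h₁⟩ := h₁ k idx
    obtain ⟨R₂, hR₂, h₂⟩ := h₂ k idx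
    refine ⟨_, hR₁.not.or hR₂, fun n _ y hy v => ?_⟩
    rw [Language.BoundedFormula.realize_imp, h₁ n y (fun R hR => hy R (.inl hR)),
      h₂ n y (fun R hR => hy R (.inr hR)), imp_iff_not_or]
  | all _ ih =>
    obtain ⟨F, hF, h⟩ := ih
    refine ⟨F, hF, fun k idx => ?_⟩
    obtain ⟨R, hR, h⟩ := h k idx
    refine ⟨_, hR.all_snoc (MvPolynomial.X 0), fun n _ y hy v => ?_⟩
    have key (z : Fin n) : (Fin.snoc (Fin.cons n fun i => (v i : ℕ)) (z : ℕ) : Fin _ → ℕ) =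
        Fin.cons n fun i => ((Fin.snoc v z : Fin _ → Fin n) i : ℕ) := by
      rw [← Fin.cons_snoc_eq_snoc_cons]
      congr 1
      ext i
      refine Fin.lastCases ?_ (fun i => ?_) i <;> simp
    simp only [Language.BoundedFormula.realize_all, h n y hy, MvPolynomial.eval_X, Fin.cons_zero,
      ← key]
    exact ⟨fun H z hz => H ⟨z, hz⟩, fun H z => H z z.2⟩

/-- Numerals with at most `J` digits in base `n` are below `n ^ J`; injectivity on `F` keeps two
relations from sharing one number. -/
theorem exists_codes {L : FirstOrder.Language.{0, 0}} {F : Set (Σ l, L.Relations l)}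
    {k J : ℕ} {idx : (Σ l, L.Relations l) → Fin k} (hidx : Set.InjOn idx F)
    (hJ : ∀ R ∈ F, R.1 ≤ J) {n : ℕ} (hn : 1 ≤ n) [L.Structure (Fin n)] :
    ∃ y : Fin k → ℕ, (∀ i, y i ≤ 2 ^ n ^ J) ∧ Codes F idx n y := by
  choose y hy h using fun i : Fin k => exists_testBit_iff (N := n ^ J) fun t =>
    ∃ R ∈ F, idx R = i ∧ ∃ a : Fin R.1 → Fin n, Language.Structure.RelMap R.2 a ∧
      (finFunctionFinEquiv a : ℕ) = t
  refine ⟨y, fun i => (hy i).le, fun R hR a => ?_⟩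
  rw [h _ _ ((Fin.is_lt _).trans_le (Nat.pow_le_pow_right hn (hJ R hR)))]
  constructor
  · exact fun H => ⟨R, hR, rfl, a, H, rfl⟩
  · rintro ⟨R', hR', e, b, H, hb⟩
    obtain rfl := hidx hR' hR e
    rwa [← finFunctionFinEquiv.injective (Fin.ext hb)]

theorem moDefinable_of_foSpec : FOSpec ⊆ MoDefinable := by
  rintro _ ⟨L, _, φ, rfl⟩
  obtain ⟨F, hF, h⟩ := exists_moClass_realize_iff φ
  -- The spare index guarantees at least one `y`, and a default value outside `F`, even when `F` is
  -- empty.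
  obtain ⟨k, idx, hidx⟩ : ∃ (k : ℕ) (idx : (Σ l, L.Relations l) → Fin (k + 1)), Set.InjOn idx F := by
    classical
    have := hF.to_subtype
    obtain ⟨k, ⟨e⟩⟩ := Finite.exists_equiv_fin F
    refine ⟨k, fun R => if hR : R ∈ F then (e ⟨R, hR⟩).castSucc else 0, fun a ha b hb hab => ?_⟩
    simpa [ha, hb] using hab
  obtain ⟨J, hJ⟩ := (hF.image Sigma.fst).bddAbove
  obtain ⟨R, hR, h⟩ := h _ idx
  refine ⟨k + 1, Nat.le_add_left _ _, fun _ => J + 1, fun _ => Nat.le_add_left _ _, R, hR, ?_⟩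
  ext n
  constructor
  · rintro ⟨M, _, _, _, hM, rfl⟩
    refine ⟨Nat.card_pos, ?_⟩
    let e := Finite.equivFin M
    let : L.Structure (Fin (Nat.card M)) := e.inducedStructure
    obtain ⟨y, hy, hc⟩ := exists_codes (J := J + 1) hidx
      (fun R hR => (hJ (Set.mem_image_of_mem _ hR)).trans (Nat.le_succ J)) (n := Nat.card M)
      Nat.card_pos
    refine ⟨y, hy, ?_⟩
    have := (h (Nat.card M) y hc _).1
      ((Language.StrongHomClass.realize_sentence e.inducedStructureEquiv φ).1 hM)
    convert this using 1
    ext i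
    fin_cases i
    rfl
  -- Any `y` codes the structure whose relations are read off its bits.
  · rintro ⟨hn, y, -, hy⟩
    let : L.Structure (Fin n) :=
      { funMap := fun f => isEmptyElim f
        RelMap := fun {l} R a => (y (idx ⟨l, R⟩)).testBit (finFunctionFinEquiv a) = true }
    refine ⟨Fin n, inferInstance, ⟨⟨0, hn⟩⟩, inferInstance, (h n y (fun R _ a => Iff.rfl) default).2 ?_,
      Nat.card_fin n⟩
    convert hy using 1
    ext i
    fin_cases i
    rfl

/-! ### First-order definable queries on tuples -/

/-- A query on `d`-tuples of elements of `L`-structures, uniformly defined by a first-order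
formula. -/
def IsFO (L : FirstOrder.Language.{0, 0}) (d : ℕ) {ι : Type}
    (Q : ∀ (M : Type) [L.Structure M], (ι → Fin d → M) → Prop) : Prop :=
  ∃ φ : L.Formula (ι × Fin d), ∀ (M : Type) [L.Structure M] (v : ι → Fin d → M),
    φ.Realize (fun p => v p.1 p.2) ↔ Q M v

section IsFO

variable {L : FirstOrder.Language.{0, 0}} {d : ℕ} {ι : Type}
  {P Q : ∀ (M : Type) [L.Structure M], (ι → Fin d → M) → Prop}

theorem IsFO.not (hP : IsFO L d P) : IsFO L d fun M _ v => ¬ P M v := by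
  obtain ⟨φ, hφ⟩ := hP
  exact ⟨φ.not, fun M _ v => by rw [Language.Formula.realize_not, hφ]⟩

theorem IsFO.and (hP : IsFO L d P) (hQ : IsFO L d Q) : IsFO L d fun M _ v => P M v ∧ Q M v := by
  obtain ⟨φ, hφ⟩ := hP
  obtain ⟨ψ, hψ⟩ := hQ
  exact ⟨φ ⊓ ψ, fun M _ v => by rw [Language.Formula.realize_inf, hφ, hψ]⟩

theorem IsFO.or (hP : IsFO L d P) (hQ : IsFO L d Q) : IsFO L d fun M _ v => P M v ∨ Q M v := by
  obtain ⟨φ, hφ⟩ := hP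
  obtain ⟨ψ, hψ⟩ := hQ
  exact ⟨φ ⊔ ψ, fun M _ v => by rw [Language.Formula.realize_sup, hφ, hψ]⟩

theorem IsFO.imp (hP : IsFO L d P) (hQ : IsFO L d Q) : IsFO L d fun M _ v => P M v → Q M v := by
  obtain ⟨φ, hφ⟩ := hP
  obtain ⟨ψ, hψ⟩ := hQ
  exact ⟨φ.imp ψ, fun M _ v => by rw [Language.Formula.realize_imp, hφ, hψ]⟩

theorem IsFO.iff (hP : IsFO L d P) (hQ : IsFO L d Q) : IsFO L d fun M _ v => P M v ↔ Q M v := by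
  obtain ⟨φ, hφ⟩ := hP
  obtain ⟨ψ, hψ⟩ := hQ
  exact ⟨φ.iff ψ, fun M _ v => by rw [Language.Formula.realize_iff, hφ, hψ]⟩

theorem IsFO.const (p : Prop) :
    IsFO L d fun _ _ (_ : ι → Fin d → _) => p := by
  by_cases h : p
  · exact ⟨⊤, fun M _ v => by simp [h]⟩
  · exact ⟨⊥, fun M _ v => by simp [h]⟩

theorem IsFO.reindex (hQ : IsFO L d Q) {κ : Type} (f : ι → κ) :
    IsFO L d fun M _ (v : κ → Fin d → M) => Q M fun i => v (f i) := by
  obtain ⟨φ, hφ⟩ := hQ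
  refine ⟨φ.relabel (Prod.map f id), fun M _ v => ?_⟩
  rw [Language.Formula.realize_relabel]
  exact hφ M fun i => v (f i)

theorem IsFO.forall_fin {β : Type} [Finite β]
    {Q : β → ∀ (M : Type) [L.Structure M], (ι → Fin d → M) → Prop} (hQ : ∀ b, IsFO L d (Q b)) :
    IsFO L d fun M _ v => ∀ b, Q b M v := by
  choose φ hφ using hQ
  exact ⟨Language.Formula.iInf φ, fun M _ v => by
    simp only [Language.Formula.realize_iInf, hφ]⟩

theorem IsFO.ex {Q : ∀ (M : Type) [L.Structure M], (Fin d → M) → (ι → Fin d → M) → Prop}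
    (hQ : IsFO L d fun M _ (v : Option ι → Fin d → M) => Q M (v none) fun i => v (some i)) :
    IsFO L d fun M _ v => ∃ z, Q M z v := by
  obtain ⟨φ, hφ⟩ := hQ
  -- Quantifying one tuple means quantifying its `d` coordinates: those of `none` become the bound
  -- block.
  let f : Option ι × Fin d → (ι × Fin d) ⊕ Fin d := fun p =>
    p.1.elim (Sum.inr p.2) fun i => Sum.inl (i, p.2)
  refine ⟨(φ.relabel f).iExs (Fin d), fun M _ v => ?_⟩
  rw [Language.Formula.realize_iExs]
  refine exists_congr fun z => ?_
  rw [Language.Formula.realize_relabel]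
  refine (iff_of_eq (congrArg _ ?_)).trans (hφ M fun o => o.elim z v)
  ext ⟨o, i⟩
  cases o <;> rfl

theorem IsFO.all {Q : ∀ (M : Type) [L.Structure M], (Fin d → M) → (ι → Fin d → M) → Prop}
    (hQ : IsFO L d fun M _ (v : Option ι → Fin d → M) => Q M (v none) fun i => v (some i)) :
    IsFO L d fun M _ v => ∀ z, Q M z v := by
  obtain ⟨φ, hφ⟩ := (IsFO.ex (Q := fun M _ z v => ¬ Q M z v) hQ.not).not
  exact ⟨φ, fun M _ v => by rw [hφ]; push Not; rfl⟩

theorem IsFO.eq_coord (i j : ι) (s t : Fin d) :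
    IsFO L d fun _ _ (v : ι → Fin d → _) => v i s = v j t :=
  ⟨(Language.Term.var (i, s)).equal (Language.Term.var (j, t)), fun M _ v => by simp⟩

theorem IsFO.eq (i j : ι) : IsFO L d fun _ _ v => v i = v j := by
  simp only [funext_iff]
  exact .forall_fin fun s => .eq_coord i j s s

/-- The tuples all of whose entries are equal. -/
def IsDiag {M : Type} (a : Fin d → M) : Prop := ∀ s t, a s = a t

theorem IsFO.isDiag (i : ι) : IsFO L d fun _ _ v => IsDiag (v i) :=
  .forall_fin fun s => .forall_fin fun t => .eq_coord i i s t

/-- The separate `t` lets the arguments be written as `![v i, v j]`, which agrees with `v ∘ ![i, j]`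
only entry by entry. -/
theorem IsFO.rel {r : ℕ} (R : L.Relations (r * d)) (f : Fin r → ι)
    {t : ∀ M : Type, (ι → Fin d → M) → Fin r → Fin d → M} (ht : ∀ M v s, t M v s = v (f s)) :
    IsFO L d fun M _ (v : ι → Fin d → M) =>
      Language.Structure.RelMap R fun i => t M v i.divNat i.modNat :=
  ⟨R.formula fun i => Language.Term.var (f i.divNat, i.modNat), fun M _ v => by
    simp only [Language.Formula.realize_rel, ht]; rfl⟩

end IsFO

/-! ### The vocabulary of arithmetic on tuples -/

/-- The relation symbols for an order, an addition, a multiplication and `k` sets on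
`d`-tuples. -/
inductive ArithRel (d k : ℕ) : ℕ → Type
  | le : ArithRel d k (2 * d)
  | add : ArithRel d k (3 * d)
  | mul : ArithRel d k (3 * d)
  | bit (i : Fin k) : ArithRel d k (1 * d)

/-- The relational language of an order, an addition, a multiplication and `k` sets on
`d`-tuples. -/
def arithLang (d k : ℕ) : FirstOrder.Language.{0, 0} := ⟨fun _ => Empty, ArithRel d k⟩

instance (d k : ℕ) : (arithLang d k).IsRelational := fun _ => inferInstanceAs (IsEmpty Empty)

section Tuples

variable {d k : ℕ} {M : Type} [(arithLang d k).Structure M]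

variable (k) in
def TupleLe (a b : Fin d → M) : Prop :=
  Language.Structure.RelMap (L := arithLang d k) ArithRel.le fun i => ![a, b] i.divNat i.modNat

variable (k) in
def TupleAdd (a b c : Fin d → M) : Prop :=
  Language.Structure.RelMap (L := arithLang d k) ArithRel.add
    fun i => ![a, b, c] i.divNat i.modNat

variable (k) in
def TupleMul (a b c : Fin d → M) : Prop :=
  Language.Structure.RelMap (L := arithLang d k) ArithRel.mul
    fun i => ![a, b, c] i.divNat i.modNat

def TupleBit (l : Fin k) (a : Fin d → M) : Prop :=
  Language.Structure.RelMap (L := arithLang d k) (ArithRel.bit l) fun i => ![a] i.divNat i.modNat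

end Tuples

section

variable {d k : ℕ} {ι : Type}

theorem IsFO.tupleLe (i j : ι) :
    IsFO (arithLang d k) d fun _ _ v => TupleLe k (v i) (v j) :=
  .rel (L := arithLang d k) ArithRel.le ![i, j] fun M v s => by fin_cases s <;> rfl

theorem IsFO.tupleAdd (i j l : ι) :
    IsFO (arithLang d k) d fun _ _ v => TupleAdd k (v i) (v j) (v l) :=
  .rel (L := arithLang d k) ArithRel.add ![i, j, l] fun M v s => by fin_cases s <;> rfl

theorem IsFO.tupleMul (i j l : ι) :
    IsFO (arithLang d k) d fun _ _ v => TupleMul k (v i) (v j) (v l) :=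
  .rel (L := arithLang d k) ArithRel.mul ![i, j, l] fun M v s => by fin_cases s <;> rfl

theorem IsFO.tupleBit (l : Fin k) (i : ι) :
    IsFO (arithLang d k) d fun _ _ v => TupleBit l (v i) :=
  .rel (L := arithLang d k) (ArithRel.bit l) ![i] fun M v s => by fin_cases s; rfl

/-- The structure on `M` whose order, addition and multiplication of tuples come from a numbering
`r` of the tuples by natural numbers and whose sets are coded by the numbers `y`. -/
@[reducible]
def structureOfRank {M : Type} (r : (Fin d → M) → ℕ) (y : Fin k → ℕ) :
    (arithLang d k).Structure M where
  funMap := fun f => isEmptyElim f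
  RelMap := fun {_} R f => match R, f with
    | ArithRel.le, f => r (fun j => f (finProdFinEquiv (0, j))) ≤
        r (fun j => f (finProdFinEquiv (1, j)))
    | ArithRel.add, f => r (fun j => f (finProdFinEquiv (0, j))) +
        r (fun j => f (finProdFinEquiv (1, j))) = r (fun j => f (finProdFinEquiv (2, j)))
    | ArithRel.mul, f => r (fun j => f (finProdFinEquiv (0, j))) *
        r (fun j => f (finProdFinEquiv (1, j))) = r (fun j => f (finProdFinEquiv (2, j)))
    | ArithRel.bit l, f => (y l).testBit (r fun j => f (finProdFinEquiv (0, j))) = true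

theorem divNat_finProdFinEquiv {m n : ℕ} (p : Fin m × Fin n) :
    (finProdFinEquiv p).divNat = p.1 := congrArg Prod.fst (finProdFinEquiv.symm_apply_apply p)

theorem modNat_finProdFinEquiv {m n : ℕ} (p : Fin m × Fin n) :
    (finProdFinEquiv p).modNat = p.2 := congrArg Prod.snd (finProdFinEquiv.symm_apply_apply p)

section

variable {M : Type} (r : (Fin d → M) → ℕ) (y : Fin k → ℕ)

theorem structureOfRank_le (a b : Fin d → M) :
    @TupleLe d k M (structureOfRank r y) a b ↔ r a ≤ r b := by
  simp [TupleLe, Language.Structure.RelMap, divNat_finProdFinEquiv, modNat_finProdFinEquiv]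

theorem structureOfRank_add (a b c : Fin d → M) :
    @TupleAdd d k M (structureOfRank r y) a b c ↔ r a + r b = r c := by
  simp [TupleAdd, Language.Structure.RelMap, divNat_finProdFinEquiv, modNat_finProdFinEquiv]

theorem structureOfRank_mul (a b c : Fin d → M) :
    @TupleMul d k M (structureOfRank r y) a b c ↔ r a * r b = r c := by
  simp [TupleMul, Language.Structure.RelMap, divNat_finProdFinEquiv, modNat_finProdFinEquiv]

theorem structureOfRank_bit (l : Fin k) (a : Fin d → M) :
    @TupleBit d k M (structureOfRank r y) l a ↔ (y l).testBit (r a) = true := by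
  simp [TupleBit, Language.Structure.RelMap, divNat_finProdFinEquiv, modNat_finProdFinEquiv]

end
end

/-! ### Axioms for finite initial segments of arithmetic -/

section Rank

variable {T : Type} (le : T → T → Prop) (add mul : T → T → T → Prop) (D : T → Prop)

/-- `b` is the immediate successor of `a`. -/
def IsSuccOf (a b : T) : Prop := ¬ le b a ∧ ∀ w, le w a ∨ le b w

/-- Axioms for a finite linear order with truncated addition and multiplication in which `D` is an
initial segment. -/
def ArithAxioms : Prop :=
  (∀ a b, le a b ∨ le b a) ∧ (∀ a b, le a b → le b a → a = b) ∧
  (∀ a b c, le a b → le b c → le a c) ∧ (∀ a b, D a → ¬ D b → le a b) ∧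
  (∀ o, (∀ w, le o w) → ∀ a c, (add a o c ↔ c = a) ∧ (mul a o c ↔ c = o)) ∧
  ∀ b b', IsSuccOf le b b' → ∀ a c, (add a b' c ↔ ∃ w, add a b w ∧ IsSuccOf le w c) ∧
    (mul a b' c ↔ ∃ w, mul a b w ∧ add w a c)

/-- `r` is an isomorphism with an initial segment of the natural numbers. -/
structure IsRank (r : T → ℕ) : Prop where
  inj : Function.Injective r
  exists_iff : ∀ t, (∃ a, r a = t) ↔ t < Nat.card T
  le_iff : ∀ a b, le a b ↔ r a ≤ r b
  add_iff : ∀ a b c, add a b c ↔ r a + r b = r c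
  mul_iff : ∀ a b c, mul a b c ↔ r a * r b = r c
  diag_iff : ∀ a, D a ↔ r a < Nat.card {a // D a}

variable {le add mul D}

theorem exists_rank_le [Finite T] (h₁ : ∀ a b, le a b ∨ le b a)
    (h₂ : ∀ a b, le a b → le b a → a = b) (h₃ : ∀ a b c, le a b → le b c → le a c) :
    ∃ r : T → ℕ, Function.Injective r ∧ (∀ t, (∃ a, r a = t) ↔ t < Nat.card T) ∧
      ∀ a b, le a b ↔ r a ≤ r b := by
  classical
  have := Fintype.ofFinite T
  let _ : LinearOrder T :=
    { le := le
      le_refl := fun a => (h₁ a a).elim id id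
      le_trans := h₃
      le_antisymm := h₂
      le_total := h₁
      toDecidableLE := Classical.decRel _ }
  let e := monoEquivOfFin T Nat.card_eq_fintype_card.symm
  refine ⟨fun a => e.symm a, fun a b h => e.symm.injective (Fin.ext h), fun t => ⟨?_, fun h => ?_⟩,
    fun a b => (e.symm.le_iff_le (x := a) (y := b)).symm⟩
  · rintro ⟨a, rfl⟩
    exact Fin.is_lt _
  · exact ⟨e ⟨t, h⟩, by simp⟩

theorem isSuccOf_iff {r : T → ℕ} (hex : ∀ t, (∃ a, r a = t) ↔ t < Nat.card T)
    (hle : ∀ a b, le a b ↔ r a ≤ r b) (a b : T) : IsSuccOf le a b ↔ r b = r a + 1 := by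
  simp only [IsSuccOf, hle]
  constructor
  · rintro ⟨h₁, h₂⟩
    obtain ⟨w, hw⟩ := (hex (r a + 1)).2 (by have := (hex _).1 ⟨b, rfl⟩; omega)
    have := h₂ w
    omega
  · intro h
    exact ⟨by omega, fun w => by omega⟩

/-- The order alone determines `r`. The recursion equations then fix addition and multiplication by
induction on the rank of the second argument; truncation is harmless because intermediate values
never exceed the result `r c`. An initial segment consists of the ranks below its cardinality. -/
theorem ArithAxioms.exists_isRank [Finite T] (h : ArithAxioms le add mul D) :
    ∃ r, IsRank le add mul D r := by
  obtain ⟨h₁, h₂, h₃, hD, h0, hs⟩ := h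
  obtain ⟨r, hr, hex, hle⟩ := exists_rank_le h₁ h₂ h₃
  simp only [isSuccOf_iff hex hle] at hs
  have hlt a : r a < Nat.card T := (hex _).1 ⟨a, rfl⟩
  have hadd (t : ℕ) : ∀ b, r b = t → ∀ a c, (add a b c ↔ r a + t = r c) := by
    induction t with
    | zero =>
      intro b hb a c
      rw [(h0 b (fun w => by rw [hle]; omega) a c).1, ← hr.eq_iff]
      omega
    | succ t ih =>
      intro b hb a c
      obtain ⟨b₀, hb₀⟩ := (hex t).2 (by have := hlt b; omega)
      simp only [(hs b₀ b (by omega) a c).1, ih b₀ hb₀]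
      constructor
      · rintro ⟨w, hw, hw'⟩
        omega
      · intro h
        obtain ⟨w, hw⟩ := (hex (r a + t)).2 (by have := hlt c; omega)
        exact ⟨w, hw.symm, by omega⟩
  have hmul (t : ℕ) : ∀ b, r b = t → ∀ a c, (mul a b c ↔ r a * t = r c) := by
    induction t with
    | zero =>
      intro b hb a c
      rw [(h0 b (fun w => by rw [hle]; omega) a c).2, ← hr.eq_iff]
      omega
    | succ t ih =>
      intro b hb a c
      obtain ⟨b₀, hb₀⟩ := (hex t).2 (by have := hlt b; omega)
      simp only [(hs b₀ b (by omega) a c).2, ih b₀ hb₀, hadd _ _ rfl, mul_add_one]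
      constructor
      · rintro ⟨w, hw, hw'⟩
        omega
      · intro h
        obtain ⟨w, hw⟩ := (hex (r a * t)).2 (by have := hlt c; omega)
        exact ⟨w, hw.symm, by omega⟩
  refine ⟨r, hr, hex, hle, fun a b c => hadd _ b rfl a c, fun a b c => hmul _ b rfl a c,
    fun a => ?_⟩
  have himage : Nat.card {a // D a} = (r '' {a | D a}).ncard :=
    (Set.ncard_image_of_injective _ hr).symm
  rw [himage]
  constructor
  · intro ha
    have hsub : Set.Iic (r a) ⊆ r '' {a | D a} := by
      intro t (ht : t ≤ r a)
      obtain ⟨b, rfl⟩ := (hex t).2 (ht.trans_lt (hlt a))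
      by_cases hb : D b
      · exact ⟨b, hb, rfl⟩
      · exact ⟨a, ha, le_antisymm ((hle a b).1 (hD a b ha hb)) ht⟩
    have := Set.ncard_le_ncard hsub (Set.toFinite _)
    rw [Set.ncard_Iic_nat] at this
    omega
  · intro ha
    by_contra hna
    have hsub : r '' {a | D a} ⊆ Set.Iio (r a) := by
      rintro _ ⟨b, hb, rfl⟩
      refine lt_of_le_of_ne ((hle b a).1 (hD b a hb hna)) fun e => hna ?_
      rwa [← hr e]
    have := Set.ncard_le_ncard hsub (Set.finite_Iio _)
    rw [Set.ncard_Iio_nat] at this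
    omega

theorem IsRank.arithAxioms {r : T → ℕ} (h : IsRank le add mul D r) : ArithAxioms le add mul D := by
  have hlt a : r a < Nat.card T := (h.exists_iff _).1 ⟨a, rfl⟩
  obtain ⟨n, hn⟩ : ∃ n, ∀ a, D a ↔ r a < n := ⟨_, h.diag_iff⟩
  simp only [ArithAxioms, isSuccOf_iff h.exists_iff h.le_iff, h.le_iff, h.add_iff, h.mul_iff,
    ← h.inj.eq_iff, hn]
  refine ⟨fun a b => by omega, fun a b => by omega, fun a b c => by omega, fun a b => by omega,
    fun o ho a c => ?_, fun b b' hb a c => ⟨⟨fun H => ?_, ?_⟩, fun H => ?_, ?_⟩⟩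
  · obtain ⟨z, hz⟩ := (h.exists_iff 0).2 (by have := hlt o; omega)
    have : r o = 0 := by have := ho z; omega
    simp only [this]
    omega
  · obtain ⟨w, hw⟩ := (h.exists_iff (r a + r b)).2 (by have := hlt c; omega)
    exact ⟨w, hw.symm, by omega⟩
  · rintro ⟨w, hw, hw'⟩
    omega
  · rw [hb, mul_add_one] at H
    obtain ⟨w, hw⟩ := (h.exists_iff (r a * r b)).2 (by have := hlt c; omega)
    exact ⟨w, hw.symm, by omega⟩
  · rintro ⟨w, hw, hw'⟩
    rw [hb, mul_add_one]
    omega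

end Rank

/-! ### Translating Mo predicates into formulas on tuples -/

/-- `r` numbers the tuples compatibly with the order, addition and multiplication of `M`, the
diagonal tuples coming first. -/
abbrev IsTupleRank (d k : ℕ) (M : Type) [(arithLang d k).Structure M] (r : (Fin d → M) → ℕ) :
    Prop :=
  IsRank (TupleLe k) (TupleAdd k) (TupleMul k) IsDiag r

theorem IsFO.arithAxioms {d k : ℕ} {ι : Type} :
    IsFO (arithLang d k) d fun M _ (_ : ι → Fin d → M) =>
      ArithAxioms (T := Fin d → M) (TupleLe k) (TupleAdd k) (TupleMul k) IsDiag := by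
  simp only [ArithAxioms, IsSuccOf]
  repeat' first
    | with_reducible exact .tupleLe _ _
    | with_reducible exact .tupleAdd _ _ _
    | with_reducible exact .tupleMul _ _ _
    | with_reducible exact .isDiag _
    | with_reducible exact .eq _ _
    | with_reducible apply IsFO.not
    | with_reducible apply IsFO.and
    | with_reducible apply IsFO.or
    | with_reducible apply IsFO.iff
    | with_reducible refine IsFO.ex ?_
    | with_reducible refine IsFO.all ?_
    | with_reducible apply IsFO.imp

theorem exists_query_eval (d k : ℕ) {m : ℕ} (p : MvPolynomial (Fin m) ℕ) :
    ∃ Q : ∀ (M : Type) [(arithLang d k).Structure M], (Fin d → M) → (Fin m → Fin d → M) → Prop,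
      IsFO (arithLang d k) d (fun M _ (v : Option (Fin m) → Fin d → M) =>
        Q M (v none) fun i => v (some i)) ∧
      ∀ (M : Type) [(arithLang d k).Structure M] (r : (Fin d → M) → ℕ), IsTupleRank d k M r →
        ∀ z v, Q M z v ↔ MvPolynomial.eval (r ∘ v) p = r z := by
  induction p using MvPolynomial.induction_on with
  | C a =>
    induction a with
    | zero =>
      refine ⟨fun M _ z v => TupleAdd k z z z, .tupleAdd _ _ _, fun M _ r hr z v => ?_⟩
      simp only [hr.add_iff, MvPolynomial.eval_C]
      omega
    | succ a ih =>
      obtain ⟨Q, hQ, h⟩ := ih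
      refine ⟨fun M _ z v => ∃ w, Q M w v ∧ IsSuccOf (TupleLe k) w z, ?_, fun M _ r hr z v => ?_⟩
      · exact .ex ((hQ.reindex fun o => o.elim none fun i => some (some i)).and
          ((IsFO.tupleLe _ _).not.and (.all ((IsFO.tupleLe _ _).or (.tupleLe _ _)))))
      · simp only [h M r hr, isSuccOf_iff hr.exists_iff hr.le_iff, MvPolynomial.eval_C]
        constructor
        · rintro ⟨w, hw, hw'⟩
          omega
        · intro e
          obtain ⟨w, hw⟩ := (hr.exists_iff a).2
            (by have := (hr.exists_iff _).1 ⟨z, rfl⟩; omega)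
          exact ⟨w, hw.symm, by omega⟩
  | add p q ihp ihq =>
    obtain ⟨P, hP, hp⟩ := ihp
    obtain ⟨Q, hQ, hq⟩ := ihq
    refine ⟨fun M _ z v => ∃ a, P M a v ∧ ∃ b, Q M b v ∧ TupleAdd k a b z, ?_,
      fun M _ r hr z v => ?_⟩
    · exact .ex ((hP.reindex fun o => o.elim none fun i => some (some i)).and
        (.ex ((hQ.reindex fun o => o.elim none fun i => some (some (some i))).and
          (.tupleAdd _ _ _))))
    · simp only [hp M r hr, hq M r hr, hr.add_iff, map_add]
      constructor
      · rintro ⟨a, ha, b, hb, e⟩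
        omega
      · intro e
        have := (hr.exists_iff _).1 ⟨z, rfl⟩
        obtain ⟨a, ha⟩ := (hr.exists_iff (MvPolynomial.eval (r ∘ v) p)).2 (by omega)
        obtain ⟨b, hb⟩ := (hr.exists_iff (MvPolynomial.eval (r ∘ v) q)).2 (by omega)
        exact ⟨a, ha.symm, b, hb.symm, by omega⟩
  | mul_X p i ih =>
    obtain ⟨P, hP, hp⟩ := ih
    -- A zero factor is treated apart: the product is then in range even if the value of `p` is not.
    -- The condition `a + a = a` says that `a` is zero.
    refine ⟨fun M _ z v => (TupleAdd k (v i) (v i) (v i) ∧ TupleAdd k z z z) ∨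
      ∃ a, P M a v ∧ TupleMul k a (v i) z, ?_, fun M _ r hr z v => ?_⟩
    · exact ((IsFO.tupleAdd _ _ _).and (.tupleAdd _ _ _)).or
        (.ex ((hP.reindex fun o => o.elim none fun i => some (some i)).and (.tupleMul _ _ _)))
    · simp only [hp M r hr, hr.add_iff, hr.mul_iff, map_mul, MvPolynomial.eval_X,
        Function.comp_apply]
      constructor
      · rintro (⟨h₁, h₂⟩ | ⟨a, ha, e⟩)
        · rw [show r (v i) = 0 by omega, show r z = 0 by omega, mul_zero]
        · rw [ha, e]
      · intro e
        rcases Nat.eq_zero_or_pos (r (v i)) with h0 | h0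
        · rw [h0, mul_zero] at e
          omega
        · have := (hr.exists_iff _).1 ⟨z, rfl⟩
          have := Nat.le_mul_of_pos_right (MvPolynomial.eval (r ∘ v) p) h0
          obtain ⟨a, ha⟩ := (hr.exists_iff (MvPolynomial.eval (r ∘ v) p)).2 (by omega)
          exact .inr ⟨a, ha.symm, by rw [ha, e]⟩

/-- The base must be at least `2`, so that powers of `n` absorb constants and the factor `2` arising
from sums. -/
theorem exists_eval_le_pow {m : ℕ} (p : MvPolynomial (Fin m) ℕ) (c : ℕ) :
    ∃ c', ∀ n, 2 ≤ n → ∀ x : Fin m → ℕ, (∀ i, x i ≤ n ^ c) → MvPolynomial.eval x p ≤ n ^ c' := by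
  induction p using MvPolynomial.induction_on with
  | C a =>
    refine ⟨a, fun n hn x _ => ?_⟩
    rw [MvPolynomial.eval_C]
    exact (Nat.lt_pow_self hn).le
  | add p q ihp ihq =>
    obtain ⟨a, ha⟩ := ihp
    obtain ⟨b, hb⟩ := ihq
    refine ⟨a + b + 1, fun n hn x hx => ?_⟩
    have h₁ : n ^ a ≤ n ^ (a + b) := Nat.pow_le_pow_right (by omega) (by omega)
    have h₂ : n ^ b ≤ n ^ (a + b) := Nat.pow_le_pow_right (by omega) (by omega)
    have h₃ : n ^ (a + b) * 2 ≤ n ^ (a + b + 1) := by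
      rw [pow_succ]
      exact Nat.mul_le_mul_left _ hn
    have := ha n hn x hx
    have := hb n hn x hx
    rw [map_add]
    omega
  | mul_X p i ih =>
    obtain ⟨a, ha⟩ := ih
    refine ⟨a + c, fun n hn x hx => ?_⟩
    rw [map_mul, MvPolynomial.eval_X, pow_add]
    exact Nat.mul_le_mul (ha n hn x hx) (hx i)

/-- The predicate `R` is expressed by first-order formulas about `d`-tuples for all sufficiently
large `d`, on arguments polynomially bounded in the size of the structure. -/
def Expressible {m k : ℕ} (R : (Fin m → ℕ) → (Fin k → ℕ) → Prop) : Prop :=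
  ∀ c, ∃ d₀, ∀ d, d₀ ≤ d →
    ∃ Q : ∀ (M : Type) [(arithLang d k).Structure M], (Fin m → Fin d → M) → Prop,
      IsFO (arithLang d k) d Q ∧
      ∀ (M : Type) [(arithLang d k).Structure M] (r : (Fin d → M) → ℕ) (y : Fin k → ℕ),
        2 ≤ Nat.card M → IsTupleRank d k M r →
        (∀ l a, TupleBit l a ↔ (y l).testBit (r a) = true) →
        ∀ v, (∀ i, r (v i) ≤ Nat.card M ^ c) → (Q M v ↔ R (r ∘ v) y)

theorem Expressible.not {m k : ℕ} {R : (Fin m → ℕ) → (Fin k → ℕ) → Prop} (h : Expressible R) :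
    Expressible fun x y => ¬ R x y := by
  intro c
  obtain ⟨d₀, h⟩ := h c
  refine ⟨d₀, fun d hd => ?_⟩
  obtain ⟨Q, hQ, h⟩ := h d hd
  exact ⟨_, hQ.not, fun M _ r y hM hr hb v hv => not_congr (h M r y hM hr hb v hv)⟩

theorem Expressible.and {m k : ℕ} {R S : (Fin m → ℕ) → (Fin k → ℕ) → Prop} (hR : Expressible R)
    (hS : Expressible S) : Expressible fun x y => R x y ∧ S x y := by
  intro c
  obtain ⟨d₁, h₁⟩ := hR c
  obtain ⟨d₂, h₂⟩ := hS c
  refine ⟨max d₁ d₂, fun d hd => ?_⟩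
  obtain ⟨Q₁, hQ₁, h₁⟩ := h₁ d (by omega)
  obtain ⟨Q₂, hQ₂, h₂⟩ := h₂ d (by omega)
  exact ⟨_, hQ₁.and hQ₂, fun M _ r y hM hr hb v hv =>
    and_congr (h₁ M r y hM hr hb v hv) (h₂ M r y hM hr hb v hv)⟩

/-- The witness is bounded by `n ^ c'`, so the induction hypothesis is used at exponent `max c c'`,
and `d ≥ c'` ensures that every witness is the rank of a tuple. -/
theorem Expressible.ex {m k : ℕ} {R : (Fin (m + 1) → ℕ) → (Fin k → ℕ) → Prop}
    (h : Expressible R) (p : MvPolynomial (Fin m) ℕ) :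
    Expressible fun x y => ∃ z < MvPolynomial.eval x p, R (Fin.cons z x) y := by
  intro c
  obtain ⟨c', hc'⟩ := exists_eval_le_pow p c
  obtain ⟨d₀, h⟩ := h (max c c')
  refine ⟨max d₀ c', fun d hd => ?_⟩
  obtain ⟨Q, hQ, h⟩ := h d (by omega)
  obtain ⟨P, hP, hp⟩ := exists_query_eval d k p
  -- `z < p` is phrased as "no `w ≤ z` equals `p`", which is right even when the value of `p` is not
  -- the rank of a tuple.
  refine ⟨fun M _ v => ∃ z, (¬ ∃ w, TupleLe k w z ∧ P M w v) ∧ Q M (Fin.cons z v), ?_, ?_⟩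
  · refine .ex (.and (.not (.ex ((IsFO.tupleLe _ _).and
      (hP.reindex fun o => o.elim none fun i => some (some i))))) ?_)
    convert hQ.reindex (Fin.cons none some : Fin (m + 1) → Option (Fin m)) using 5 with M _ v
    ext1 i
    refine Fin.cases ?_ (fun i => ?_) i <;> simp
  · intro M _ r y hM hr hb v hv
    have hcard : Nat.card (Fin d → M) = Nat.card M ^ d := by rw [Nat.card_fun, Nat.card_fin]
    have hpow {a b : ℕ} (hab : a ≤ b) : Nat.card M ^ a ≤ Nat.card M ^ b :=
      Nat.pow_le_pow_right (by omega) hab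
    have hpx := hc' _ hM _ hv
    have hlt (z) : (¬ ∃ w, TupleLe k w z ∧ P M w v) ↔ r z < MvPolynomial.eval (r ∘ v) p := by
      simp only [hp M r hr, hr.le_iff]
      rw [← not_le, not_iff_not]
      constructor
      · rintro ⟨w, hw, e⟩
        omega
      · intro hz
        obtain ⟨w, hw⟩ := (hr.exists_iff _).2 (hz.trans_lt ((hr.exists_iff _).1 ⟨z, rfl⟩))
        exact ⟨w, by omega, hw.symm⟩
    have hcons (z) (hz : r z < MvPolynomial.eval (r ∘ v) p) :
        Q M (Fin.cons z v) ↔ R (Fin.cons (r z) (r ∘ v)) y := by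
      rw [h M r y hM hr hb, Fin.comp_cons]
      refine Fin.cases ?_ fun i => ?_
      · exact (hz.le.trans hpx).trans (hpow (by omega))
      · exact (hv i).trans (hpow (by omega))
    simp only [hlt]
    constructor
    · rintro ⟨z, hz, H⟩
      exact ⟨r z, hz, (hcons z hz).1 H⟩
    · rintro ⟨t, ht, H⟩
      obtain ⟨z, rfl⟩ := (hr.exists_iff t).2
        (by rw [hcard]; exact (ht.trans_le hpx).trans_le (hpow (by omega)))
      exact ⟨z, ht, (hcons z ht).2 H⟩

theorem MoClass.expressible {m k : ℕ} {R : (Fin m → ℕ) → (Fin k → ℕ) → Prop} (h : MoClass R) :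
    Expressible R := by
  induction h with
  | add i j l =>
    exact fun c => ⟨0, fun d _ => ⟨_, .tupleAdd i j l, fun M _ r y _ hr _ v _ => hr.add_iff _ _ _⟩⟩
  | mul i j l =>
    exact fun c => ⟨0, fun d _ => ⟨_, .tupleMul i j l, fun M _ r y _ hr _ v _ => hr.mul_iff _ _ _⟩⟩
  | bit i j => exact fun c => ⟨0, fun d _ => ⟨_, .tupleBit i j, fun M _ r y _ _ hb v _ => hb _ _⟩⟩
  | not _ ih => exact ih.not
  | and _ _ ih₁ ih₂ => exact ih₁.and ih₂
  | or _ _ ih₁ ih₂ => simpa only [not_and_or, not_not] using (ih₁.not.and ih₂.not).not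
  | all p _ ih => simpa only [not_exists, not_and, not_not] using (ih.not.ex p).not
  | ex p _ ih => exact ih.ex p

/-! ### Mo-definable sets are spectra -/

/-- This replaces the exponential bound by a condition on bits: the first disjunct is `y < 2 ^ t`,
the second `y = 2 ^ t`. -/
theorem le_two_pow_iff_testBit (y t : ℕ) :
    y ≤ 2 ^ t ↔ (∀ s, y.testBit s = true → s < t) ∨ ∀ s, y.testBit s = true ↔ s = t := by
  rw [le_iff_lt_or_eq]
  refine or_congr ⟨fun h s hs => ?_, fun h => ?_⟩ ⟨?_, fun h => ?_⟩
  · by_contra hst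
    exact absurd (Nat.ge_two_pow_of_testBit hs) (not_le.2 (h.trans_le
      (Nat.pow_le_pow_right two_pos (not_lt.1 hst))))
  · refine Nat.lt_pow_two_of_testBit y fun s hs => ?_
    by_contra hb
    exact absurd (h s (by simpa using hb)) (not_lt.2 hs)
  · rintro rfl s
    simp [Nat.testBit_two_pow, eq_comm]
  · refine Nat.eq_of_testBit_eq fun s => ?_
    rw [Bool.eq_iff_iff, h]
    simp [Nat.testBit_two_pow, eq_comm]

theorem card_isDiag {d : ℕ} (hd : 0 < d) (M : Type) :
    Nat.card {a : Fin d → M // IsDiag a} = Nat.card M :=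
  Nat.card_congr
    { toFun := fun a => a.1 ⟨0, hd⟩
      invFun := fun e => ⟨fun _ => e, fun _ _ => rfl⟩
      left_inv := fun a => Subtype.ext (funext fun _ => a.2 _ _)
      right_inv := fun _ => rfl }

theorem exists_not_isDiag_iff {d : ℕ} (hd : 2 ≤ d) (M : Type) :
    (∃ a : Fin d → M, ¬ IsDiag a) ↔ Nontrivial M := by
  constructor
  · rintro ⟨a, ha⟩
    simp only [IsDiag, not_forall] at ha
    obtain ⟨s, t, h⟩ := ha
    exact ⟨_, _, h⟩
  · rintro ⟨x, y, h⟩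
    refine ⟨fun i => if i = ⟨0, by omega⟩ then x else y, fun H => h ?_⟩
    have := H ⟨0, by omega⟩ ⟨1, by omega⟩
    simpa [Fin.ext_iff] using this

/-- The injection sending a constant tuple to its value extends to a bijection of all tuples with
the numbers below `n ^ d`; the values below `n` are already taken by the diagonal. -/
theorem exists_rank_fin {d : ℕ} (hd : 0 < d) (n : ℕ) : ∃ r : (Fin d → Fin n) → ℕ,
    Function.Injective r ∧ (∀ t, (∃ a, r a = t) ↔ t < Nat.card (Fin d → Fin n)) ∧
      ∀ a, IsDiag a ↔ r a < Nat.card {a : Fin d → Fin n // IsDiag a} := by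
  have hcard : Fintype.card (Fin d → Fin n) = (Finset.range (n ^ d)).card := by simp
  obtain ⟨g, hg⟩ := Set.MapsTo.exists_equiv_extend_of_card_eq hcard
    (s := {a | IsDiag a}) (f := fun a => (a ⟨0, hd⟩ : ℕ))
    (fun a _ => by
      rw [Finset.coe_range]
      exact (a _).2.trans_le (Nat.le_self_pow hd.ne' n))
    (fun a ha b hb h => funext fun i => by
      rw [ha i ⟨0, hd⟩, hb i ⟨0, hd⟩]
      exact Fin.ext h)
  refine ⟨fun a => g a, fun a b h => g.injective (Subtype.ext h), fun t => ⟨?_, fun h => ?_⟩,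
    fun a => ?_⟩
  · rintro ⟨a, rfl⟩
    rw [Nat.card_fun, Nat.card_fin, Nat.card_fin]
    exact Finset.mem_range.1 (g a).2
  · exact ⟨g.symm ⟨t, by simpa using h⟩, by simp⟩
  · rw [card_isDiag hd, Nat.card_fin]
    constructor
    · intro ha
      exact (hg a ha).trans_lt (a _).2
    · intro ha
      have hb : IsDiag fun _ : Fin d => (⟨g a, ha⟩ : Fin n) := fun _ _ => rfl
      have := g.injective (Subtype.ext (hg _ hb))
      rwa [this] at hb

theorem IsFO.exists_sentence {L : FirstOrder.Language.{0, 0}} {d : ℕ}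
    {P : ∀ (M : Type) [L.Structure M], Prop}
    (h : IsFO L d fun M _ (_ : Empty → Fin d → M) => P M) :
    ∃ φ : L.Sentence, ∀ (M : Type) [L.Structure M], M ⊨ φ ↔ P M := by
  obtain ⟨φ, h⟩ := h
  refine ⟨φ.relabel Prod.fst, fun M _ => ?_⟩
  rw [Language.Sentence.Realize, Language.Formula.realize_relabel]
  exact (iff_of_eq (congrArg _ (funext fun p => p.1.elim))).trans (h M fun e => e.elim)

theorem foSpec_of_moDefinable : MoDefinable ⊆ FOSpec := by
  rintro S ⟨k, -, j, -, R, hR, hS⟩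
  obtain ⟨d₀, h⟩ := hR.expressible 1
  -- Large enough for `R` to be expressible, and for `n` and every `n ^ j i` to lie below `n ^ d`
  -- when `n ≥ 2`.
  let d := d₀ + 2 + ∑ i, j i
  have hjd (i) : j i < d := by
    have := Finset.single_le_sum (f := j) (fun _ _ => Nat.zero_le _) (Finset.mem_univ i)
    omega
  have hd2 : 2 ≤ d := by omega
  obtain ⟨Q, hQ, h⟩ := h d (by omega)
  choose P hP hp using fun i => exists_query_eval d k (MvPolynomial.X (0 : Fin 1) ^ j i)
  clear_value d
  -- The tuple `x` has rank `n`, since exactly the diagonal precedes it; `w` has rank `n ^ j l`, and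
  -- the disjunction says `y l ≤ 2 ^ (n ^ j l)`.
  let Ψ (M : Type) [(arithLang d k).Structure M] : Prop := ∃ x : Fin d → M,
    (∀ z, ¬ TupleLe k x z ↔ IsDiag z) ∧ (∀ l, ∃ w, P l M w (fun _ => x) ∧
      ((∀ z, TupleBit l z → ¬ TupleLe k w z) ∨ ∀ z, TupleBit l z ↔ z = w)) ∧ Q M fun _ => x
  have hΨ : IsFO (arithLang d k) d fun M _ (_ : Empty → Fin d → M) => Ψ M := by
    refine .ex (.and (.all (.iff (.not (.tupleLe _ _)) (.isDiag _)))
      (.and (.forall_fin fun l => .ex (.and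
        ((hP l).reindex fun o => o.elim none fun _ => some none)
        (.or (.all (.imp (.tupleBit _ _) (.not (.tupleLe _ _))))
          (.all (.iff (.tupleBit _ _) (.eq _ _)))))) (hQ.reindex fun _ => none)))
  have key (M : Type) [(arithLang d k).Structure M] (hM : 2 ≤ Nat.card M) (r : (Fin d → M) → ℕ)
      (hr : IsTupleRank d k M r) (y : Fin k → ℕ) (hy : ∀ l, y l < 2 ^ Nat.card M ^ d)
      (hb : ∀ l a, TupleBit l a ↔ (y l).testBit (r a) = true) :
      Ψ M ↔ (∀ l, y l ≤ 2 ^ Nat.card M ^ j l) ∧ R ![Nat.card M] y := by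
    have hcard : Nat.card (Fin d → M) = Nat.card M ^ d := by rw [Nat.card_fun, Nat.card_fin]
    have hsurj (t : ℕ) (ht : t < Nat.card M ^ d) : ∃ a, r a = t := (hr.exists_iff t).2 (hcard ▸ ht)
    obtain ⟨x, hx⟩ := hsurj (Nat.card M) (lt_self_pow₀ hM hd2)
    have hx' (x') : (∀ z, ¬ TupleLe k x' z ↔ IsDiag z) ↔ x' = x := by
      have hdiag := hr.diag_iff
      rw [card_isDiag (by omega)] at hdiag
      simp only [hdiag, hr.le_iff, not_le]
      constructor
      · intro H
        have h₁ := H x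
        have h₂ := H x'
        exact hr.inj (by omega)
      · rintro rfl z
        rw [hx]
    have hbit (l w) (hw : r w = Nat.card M ^ j l) :
        ((∀ z, TupleBit l z → ¬ TupleLe k w z) ∨ ∀ z, TupleBit l z ↔ z = w) ↔
          y l ≤ 2 ^ Nat.card M ^ j l := by
      -- By `hy`, every bit set in `y l` has the rank of a tuple, so quantifying over tuples
      -- inspects all of them.
      have hlt (s) (hs : (y l).testBit s = true) : ∃ z, r z = s := by
        refine hsurj s ?_
        by_contra hsN
        exact absurd (Nat.ge_two_pow_of_testBit hs) (not_le.2 ((hy l).trans_le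
          (Nat.pow_le_pow_right two_pos (not_lt.1 hsN))))
      rw [le_two_pow_iff_testBit, ← hw]
      simp only [hb, hr.le_iff, not_le, ← hr.inj.eq_iff]
      refine or_congr ⟨fun H s hs => ?_, fun H z => H _⟩ ⟨fun H s => ?_, fun H z => H _⟩
      · obtain ⟨z, rfl⟩ := hlt s hs
        exact H z hs
      · constructor
        · intro hs
          obtain ⟨z, rfl⟩ := hlt s hs
          exact (H z).1 hs
        · rintro rfl
          exact (H w).2 rfl
    have hrx : r ∘ (fun _ : Fin 1 => x) = ![Nat.card M] := by
      ext i
      fin_cases i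
      exact hx
    simp only [Ψ, hx', exists_eq_left, hp _ M r hr]
    rw [h M r y hM hr hb _ (fun _ => by rw [pow_one, hx]), hrx]
    refine and_congr_left fun _ => forall_congr' fun l => ?_
    simp only [map_pow, MvPolynomial.eval_X, Matrix.cons_val_fin_one]
    constructor
    · rintro ⟨w, hw, H⟩
      exact (hbit l w hw.symm).1 H
    · intro H
      obtain ⟨w, hw⟩ := hsurj _ (Nat.pow_lt_pow_right hM (hjd l))
      exact ⟨w, hw.symm, (hbit l w hw).2 H⟩
  -- A non-diagonal tuple exists exactly when there are at least two elements; the one-element case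
  -- is decided by the constant `1 ∈ S`.
  obtain ⟨φ, hφ⟩ := IsFO.exists_sentence
    (P := fun (M : Type) [(arithLang d k).Structure M] =>
      ((∃ a : Fin d → M, ¬ IsDiag a) ∧ ArithAxioms (T := Fin d → M) (TupleLe k) (TupleAdd k)
        (TupleMul k) IsDiag ∧ Ψ M) ∨ ((¬ ∃ a : Fin d → M, ¬ IsDiag a) ∧ 1 ∈ S))
    (((IsFO.ex (.not (.isDiag _))).and (IsFO.arithAxioms.and hΨ)).or
      ((IsFO.ex (.not (.isDiag _))).not.and (.const _)))
  refine ⟨arithLang d k, inferInstance, φ, ?_⟩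
  simp only [exists_not_isDiag_iff hd2] at hφ
  ext n
  constructor
  · intro hn
    obtain ⟨hn1, y, hy, hRy⟩ : 1 ≤ n ∧ ∃ y : Fin k → ℕ, (∀ i, y i ≤ 2 ^ (n ^ j i)) ∧ R ![n] y := by
      rwa [hS] at hn
    obtain ⟨r, hinj, hex, hdiag⟩ := exists_rank_fin (by omega : 0 < d) n
    let _ := structureOfRank r y
    refine ⟨Fin n, inferInstance, ⟨⟨0, hn1⟩⟩, inferInstance, (hφ _).2 ?_, Nat.card_fin n⟩
    rcases hn1.lt_or_eq with hn2 | rfl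
    · have hr : IsTupleRank d k (Fin n) r := ⟨hinj, hex, structureOfRank_le r y,
        structureOfRank_add r y, structureOfRank_mul r y, hdiag⟩
      refine .inl ⟨Fin.nontrivial_iff_two_le.2 hn2, hr.arithAxioms, ?_⟩
      rw [key (Fin n) (by rwa [Nat.card_fin]) r hr y ?_ (structureOfRank_bit r y), Nat.card_fin]
      · exact ⟨hy, hRy⟩
      · intro l
        rw [Nat.card_fin]
        exact (hy l).trans_lt (Nat.pow_lt_pow_right one_lt_two (Nat.pow_lt_pow_right hn2 (hjd l)))
    · exact .inr ⟨not_nontrivial _, hn⟩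
  · rintro ⟨M, _, _, _, hM, rfl⟩
    rcases (hφ M).1 hM with ⟨hnt, hax, H⟩ | ⟨hnt, h1⟩
    · obtain ⟨r, hr⟩ := hax.exists_isRank
      -- The numbers `y` are read off from the sets of tuples through the ranks.
      choose y hy hyb using fun l : Fin k => exists_testBit_iff (N := Nat.card M ^ d) fun t =>
        ∃ a, r a = t ∧ TupleBit l a
      rw [key M Finite.one_lt_card r hr y hy] at H
      · rw [hS]
        exact ⟨Nat.card_pos, y, H⟩
      · intro l a
        rw [hyb l (r a) (by
          have := (hr.exists_iff _).1 ⟨a, rfl⟩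
          rwa [Nat.card_fun, Nat.card_fin] at this)]
        exact ⟨fun hba => ⟨a, rfl, hba⟩, fun ⟨b, e, hba⟩ => hr.inj e ▸ hba⟩
    · rw [not_nontrivial_iff_subsingleton] at hnt
      rwa [Nat.card_of_subsingleton (Classical.arbitrary M)]

end MoSpectra

theorem mainTheorem5 : MoSpectra.FOSpec = MoSpectra.MoDefinable :=
  Set.Subset.antisymm MoSpectra.moDefinable_of_foSpec MoSpectra.foSpec_of_moDefinable
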